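/- Let $(R,\mathfrak m)$ be a commutative Noetherian local domain whose integral closure $\overline{R}$ in its field of fractions is a finitely generated $R$-module but is not a local ring. Assume that $R$ is of isolated singularity, i.e. $R_{\mathfrak q}$ is a regular local ring for every prime ideal $\mathfrak q\neq\mathfrak m$ of $R$. Let $\widehat{\ \cdot\ }$ denote $\mathfrak m$-adic completion of $R$-modules. Call a finitely generated $\widehat R$-module $\mathcal M$ algebraic if $\mathcal M\cong\widehat M$ as $\widehat R$-modules for some finitely generated $R$-module $M$, and strongly algebraic if every direct summand of $\mathcal M$ is algebraic. Then $\widehat{\overline R}$ is a finitely generated $\widehat R$-module that is algebraic but not strongly algebraic. More precisely, there are only finitely many prime ideals $\mathfrak p_1,\dots,\mathfrak p_n$ of $\overline R$ lying over $\mathfrak m$, the natural map $$\widehat{\overline R}\longrightarrow \widehat{\overline R_{\mathfrak p_1}}\oplus\cdots\oplus\widehat{\overline R_{\mathfrak p_n}}$$ is an isomorphism of $\widehat R$-modules, and none of the direct summands $\widehat{\overline R_{\mathfrak p_i}}$ is algebraic. -/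

import Mathlib

universe u v

/-- A commutative Noetherian local ring `R` is *of isolated singularity* if its localization at
every prime ideal other than the maximal ideal is a regular local ring. -/
def HasIsolatedSingularity (R : Type u) [CommRing R] [IsLocalRing R] : Prop :=
  ∀ (q : Ideal R) [q.IsPrime], q ≠ IsLocalRing.maximalIdeal R →
    IsRegularLocalRing (Localization.AtPrime q)

/-- The `𝔪`-adic completion of a module `M` over a local ring `(R, 𝔪)`. For `M = R` it is the
completed ring, and in general it is a module over that ring. -/
abbrev MaxCompletion (R : Type u) [CommRing R] [IsLocalRing R]
    (M : Type v) [AddCommGroup M] [Module R M] : Type v :=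
  AdicCompletion (IsLocalRing.maximalIdeal R) M

/-- A module `N` over the completion of the local ring `R` is *algebraic* (extended from a finitely
generated `R`-module) if it is isomorphic, over the completion of `R`, to the completion of a
finitely generated `R`-module. Every finitely generated `R`-module is isomorphic to one living in
the universe of `R`, so the universe of `M` is no restriction. -/
def IsAlgebraicModule (R : Type u) [CommRing R] [IsLocalRing R]
    (N : Type v) [AddCommGroup N] [Module (MaxCompletion R R) N] : Prop :=
  ∃ (M : Type u) (_ : AddCommGroup M) (_ : Module R M),
    Module.Finite R M ∧ Nonempty (MaxCompletion R M ≃ₗ[MaxCompletion R R] N)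

/-- A module over the completion of the local ring `R` is *strongly algebraic* if each of its
direct summands is algebraic. -/
def IsStronglyAlgebraicModule (R : Type u) [CommRing R] [IsLocalRing R]
    (N : Type v) [AddCommGroup N] [Module (MaxCompletion R R) N] : Prop :=
  ∀ N₁ N₂ : Submodule (MaxCompletion R R) N, IsCompl N₁ N₂ → IsAlgebraicModule R N₁

/-- For an algebra `S` over the local ring `(R, 𝔪)`, the canonical map from the `𝔪`-adic completion
of `S` to the product, over the primes `P` of `S` lying over `𝔪`, of the `𝔪`-adic completions of
the localizations of `S` at `P`; it is induced by the localization maps. -/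
noncomputable def completionToLocalCompletions (R : Type u) [CommRing R] [IsLocalRing R]
    (S : Type v) [CommRing S] [Algebra R S] :
    MaxCompletion R S →ₗ[MaxCompletion R R]
      ((P : (IsLocalRing.maximalIdeal R).primesOver S) →
        MaxCompletion R (Localization.AtPrime P.1)) :=
  LinearMap.pi fun P => AdicCompletion.map (IsLocalRing.maximalIdeal R)
    (IsScalarTower.toAlgHom R S (Localization.AtPrime P.1)).toLinearMap

open IsLocalRing

/-! ### Splitting the completion of a semilocal algebra over its maximal ideals. -/

section SemilocalCompletion

/-! Let `S` be the integral closure. Being finite, it is semilocal, so the Chinese remainder theorem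
splits its completion into those of the `S_P` (`bijective_completionToLocalCompletions`). A common
denominator `f` embeds `S` in `R` by `F x = f x`, and completion keeps `F` injective. For `Q ≠ P`,
let `e` be the idempotent of the `Q` factor: `a = F̂(e)` is nonzero, yet maps to `f e_P = 0` in
`Ŝ_P`, so `a` kills `Ŝ_P`. If `Ŝ_P ≅ M̂`, then `M` is torsion, since a nontorsion element would
embed `R̂` in `M̂`. So some nonzero `g` in `R` kills `M`, hence `Ŝ_P`. But `Ŝ_P` is a nonzero
summand of `Ŝ`, which embeds in `R̂`, where `g` is regular: contradiction. -/

theorem mem_smul_top_localization_iff {R : Type u} [CommRing R] {S : Type v} [CommRing S]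
    [Algebra R S] (I : Ideal R) (P : Ideal S) [P.IsPrime]
    (y : Localization.AtPrime P) :
    y ∈ (I • ⊤ : Submodule R (Localization.AtPrime P)) ↔
      y ∈ (I.map (algebraMap R S)).map (algebraMap S (Localization.AtPrime P)) := by
  rw [Ideal.smul_top_eq_map, Submodule.restrictScalars_mem, Ideal.map_map,
    ← IsScalarTower.algebraMap_eq]

variable {R : Type u} [CommRing R] [IsLocalRing R] {S : Type v} [CommRing S] [Algebra R S]

theorem mem_primesOver_maximalIdeal_of_isMaximal [Algebra.IsIntegral R S] (P : Ideal S)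
    [P.IsMaximal] : P ∈ (maximalIdeal R).primesOver S :=
  ⟨inferInstance,
    ⟨(eq_maximalIdeal (Ideal.isMaximal_comap_of_isIntegral_of_isMaximal (R := R) P)).symm⟩⟩

/-- Membership in `I S` can be tested in the localizations at the primes over `𝔪`. -/
theorem mem_smul_top_of_localization [Algebra.IsIntegral R S] (I : Ideal R) (x : S)
    (hx : ∀ P : (maximalIdeal R).primesOver S,
      algebraMap S (Localization.AtPrime P.1) x ∈
        (I • ⊤ : Submodule R (Localization.AtPrime P.1))) :
    x ∈ (I • ⊤ : Submodule R S) := by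
  rw [Ideal.smul_top_eq_map, Submodule.restrictScalars_mem]
  refine Ideal.mem_of_localization_maximal fun P hP => ?_
  exact (mem_smul_top_localization_iff I P _).1
    (hx ⟨P, mem_primesOver_maximalIdeal_of_isMaximal P⟩)

/-- Every prime containing `𝔪^k S` lies over `𝔪`, so the product lies in the radical of `𝔪^k S`. -/
theorem exists_prod_primesOver_pow_le [IsNoetherianRing S]
    [Fintype ((maximalIdeal R).primesOver S)] (k : ℕ) :
    ∃ N : ℕ, (∏ Q : (maximalIdeal R).primesOver S, Q.1) ^ N ≤
      ((maximalIdeal R) ^ k).map (algebraMap R S) := by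
  set J := ((maximalIdeal R) ^ k).map (algebraMap R S) with hJ
  obtain ⟨N, hN⟩ := J.exists_radical_pow_le_of_fg (IsNoetherian.noetherian _)
  refine ⟨N, (Ideal.pow_right_mono ?_ N).trans hN⟩
  rw [Ideal.radical_eq_sInf]
  refine le_sInf fun Q ⟨hJQ, hQ⟩ => ?_
  have hle : (maximalIdeal R) ^ k ≤ Q.comap (algebraMap R S) := Ideal.map_le_iff_le_comap.1 hJQ
  have hle' := Ideal.IsPrime.le_of_pow_le hle
  have heq := (maximalIdeal.isMaximal R).eq_of_le (Ideal.IsPrime.ne_top inferInstance) hle'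
  have hmem : Q ∈ (maximalIdeal R).primesOver S := ⟨hQ, ⟨heq⟩⟩
  exact Ideal.prod_le_inf.trans (Finset.inf_le (Finset.mem_univ (⟨Q, hmem⟩ :
    (maximalIdeal R).primesOver S)))

/-- The primes over `𝔪` are maximal, so the factors other than `P` become the unit ideal in `S_P`.
-/
theorem map_pow_le_of_prod_primesOver_pow_le [Algebra.IsIntegral R S]
    [Fintype ((maximalIdeal R).primesOver S)] {J : Ideal S} {N : ℕ}
    (hN : (∏ Q : (maximalIdeal R).primesOver S, Q.1) ^ N ≤ J)
    (P : (maximalIdeal R).primesOver S) :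
    (P.1 ^ N).map (algebraMap S (Localization.AtPrime P.1)) ≤
      J.map (algebraMap S (Localization.AtPrime P.1)) := by
  classical
  have hrest : (∏ Q ∈ Finset.univ.erase P, Q.1).map
      (algebraMap S (Localization.AtPrime P.1)) = ⊤ := by
    by_contra hne
    have hle : ∏ Q ∈ Finset.univ.erase P, Q.1 ≤ P.1 := by
      rw [← Localization.AtPrime.under_maximalIdeal (I := P.1), Ideal.under_def,
        ← Ideal.map_le_iff_le_comap]
      exact le_maximalIdeal hne
    obtain ⟨Q, hQ, hQP⟩ := (Ideal.IsPrime.prod_le inferInstance).1 hle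
    exact (Finset.mem_erase.1 hQ).1
      (Subtype.ext (Ideal.IsMaximal.eq_of_le inferInstance (Ideal.IsPrime.ne_top inferInstance) hQP))
  calc (P.1 ^ N).map (algebraMap S (Localization.AtPrime P.1))
      = ((∏ Q : (maximalIdeal R).primesOver S, Q.1) ^ N).map
          (algebraMap S (Localization.AtPrime P.1)) := by
        rw [← Finset.mul_prod_erase Finset.univ _ (Finset.mem_univ P), Ideal.map_pow,
          Ideal.map_pow, Ideal.map_mul, hrest, Ideal.mul_top]
    _ ≤ _ := Ideal.map_mono hN

/-- Over a maximal ideal `P`, each element of `S_P` agrees with an element of `S` modulo any power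
of `P S_P`. -/
theorem exists_algebraMap_sub_mem_map_pow (P : Ideal S) [hP : P.IsMaximal] (N : ℕ)
    (y : Localization.AtPrime P) :
    ∃ z : S, algebraMap S (Localization.AtPrime P) z - y ∈
      (P ^ N).map (algebraMap S (Localization.AtPrime P)) := by
  obtain ⟨a, s, rfl⟩ := IsLocalization.exists_mk'_eq P.primeCompl y
  -- `t` inverts `s` modulo `P ^ N`, so `a * t` approximates `a / s`.
  obtain ⟨t, i, hi, hti⟩ := Ideal.IsMaximal.exists_inv_pow P s.2 N
  refine ⟨a * t, ?_⟩
  have key : algebraMap S (Localization.AtPrime P) (a * t) - IsLocalization.mk' _ a s =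
      -(IsLocalization.mk' (Localization.AtPrime P) a s) *
        algebraMap S (Localization.AtPrime P) i := by
    have h := IsLocalization.mk'_spec (Localization.AtPrime P) a s
    rw [eq_sub_of_add_eq' hti, map_sub, map_one, map_mul, map_mul]
    linear_combination (-algebraMap S (Localization.AtPrime P) t) * h
  rw [key]
  exact Ideal.mul_mem_left _ _ (Ideal.mem_map_of_mem _ hi)

theorem exists_forall_algebraMap_sub_mem [Algebra.IsIntegral R S] [IsNoetherianRing S]
    [Finite ((maximalIdeal R).primesOver S)] (k : ℕ)
    (y : (P : (maximalIdeal R).primesOver S) → Localization.AtPrime P.1) :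
    ∃ x : S, ∀ P, algebraMap S (Localization.AtPrime P.1) x - y P ∈
      ((maximalIdeal R) ^ k • ⊤ : Submodule R (Localization.AtPrime P.1)) := by
  have := Fintype.ofFinite ((maximalIdeal R).primesOver S)
  obtain ⟨N, hN⟩ := exists_prod_primesOver_pow_le (R := R) (S := S) k
  choose z hz using fun P : (maximalIdeal R).primesOver S =>
    exists_algebraMap_sub_mem_map_pow P.1 N (y P)
  obtain ⟨x, hx⟩ := Ideal.exists_forall_sub_mem_ideal
    (I := fun P : (maximalIdeal R).primesOver S => P.1 ^ N)
    (fun P Q hPQ => IsCoprime.pow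
      (Ideal.isCoprime_of_isMaximal (fun h => hPQ (Subtype.ext h)))) z
  refine ⟨x, fun P => ?_⟩
  rw [mem_smul_top_localization_iff]
  refine map_pow_le_of_prod_primesOver_pow_le hN P ?_
  rw [← sub_add_sub_cancel _ (algebraMap S (Localization.AtPrime P.1) (z P)), ← map_sub]
  exact add_mem (Ideal.mem_map_of_mem _ (hx P)) (hz P)

theorem bijective_completionToLocalCompletions [Algebra.IsIntegral R S] [IsNoetherianRing S]
    [Finite ((maximalIdeal R).primesOver S)] :
    Function.Bijective (completionToLocalCompletions R S) := by
  constructor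
  · rw [injective_iff_map_eq_zero]
    intro x hx
    refine AdicCompletion.ext fun k => ?_
    obtain ⟨s, hs⟩ := Submodule.Quotient.mk_surjective _ (x.val k)
    rw [← hs, AdicCompletion.val_zero_apply, Submodule.Quotient.mk_eq_zero]
    refine mem_smul_top_of_localization _ _ fun P => ?_
    have h := congrArg (fun z => (z P).val k) hx
    simp only [completionToLocalCompletions, LinearMap.pi_apply, AdicCompletion.map_val_apply,
      ← hs, LinearMap.reduceModIdeal_apply, Pi.zero_apply, AdicCompletion.val_zero_apply,
      Submodule.Quotient.mk_eq_zero] at h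
    exact h
  · intro y
    choose r hr using fun k P => Submodule.Quotient.mk_surjective _ ((y P).val k)
    choose x hx using fun k => exists_forall_algebraMap_sub_mem (R := R) (S := S) k (r k)
    refine ⟨⟨fun k => Submodule.Quotient.mk (x k), fun {m n} hmn => ?_⟩, ?_⟩
    · change Submodule.Quotient.mk (x n) = Submodule.Quotient.mk (x m)
      rw [Submodule.Quotient.eq]
      -- The independently chosen approximations `x k` are coherent because congruence modulo `𝔪^m
      -- S` can be checked in each `S_P`.
      refine mem_smul_top_of_localization _ _ fun P => ?_
      have h1 := hx m P
      have h2 := Submodule.smul_mono_left (Ideal.pow_le_pow_right hmn) (hx n P)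
      have h3 : r n P - r m P ∈ ((maximalIdeal R) ^ m • ⊤ :
          Submodule R (Localization.AtPrime P.1)) := by
        rw [← Submodule.Quotient.eq, hr m P, ← (y P).2 hmn]
        exact congrArg (AdicCompletion.transitionMap (maximalIdeal R) _ hmn) (hr n P)
      have h4 := sub_mem (add_mem h2 h3) h1
      rw [map_sub]
      convert h4 using 1
      ring
    · funext P
      refine AdicCompletion.ext fun k => ?_
      rw [← hr k P]
      change Submodule.Quotient.mk (algebraMap S (Localization.AtPrime P.1) (x k)) = _
      rw [Submodule.Quotient.eq]
      exact hx k P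

end SemilocalCompletion

/-! ### Annihilators and the obstruction to algebraicity. -/

section AlgebraicModules

theorem AdicCompletion.map_injective_of_finite {R : Type u} [CommRing R] [IsNoetherianRing R]
    (I : Ideal R) {S : Type v} [AddCommGroup S] [Module R S] [Module.Finite R S]
    {F : S →ₗ[R] R} (hF : Function.Injective F) :
    Function.Injective (AdicCompletion.map I F) := by
  -- A quotient of `R^n` replaces `S` by a module in the universe of `R`.
  obtain ⟨n, N, ⟨e⟩⟩ := Module.Finite.exists_fin_quot_equiv R S
  have h := AdicCompletion.map_injective I (f := F ∘ₗ e.toLinearMap) (hF.comp e.injective)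
  rw [← AdicCompletion.map_comp] at h
  exact (Function.Injective.of_comp_iff' (AdicCompletion.map I F)
    (AdicCompletion.congr I e).bijective).1 h

/-- At level `k`, `a` acts through its image in `A / I^k A`. -/
theorem AdicCompletion.smul_eq_zero_of_map_linearMap_eq_zero {R : Type u} [CommRing R]
    (I : Ideal R) {A : Type v} [CommRing A] [Algebra R A] {a : AdicCompletion I R}
    (ha : AdicCompletion.map I (Algebra.linearMap R A) a = 0) (y : AdicCompletion I A) :
    a • y = 0 := by
  refine AdicCompletion.ext fun k => ?_
  obtain ⟨r, hr⟩ := Submodule.Quotient.mk_surjective _ (a.val k)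
  obtain ⟨z, hz⟩ := Submodule.Quotient.mk_surjective _ (y.val k)
  have h := congrArg (fun t => t.val k) ha
  simp only [AdicCompletion.map_val_apply, ← hr, LinearMap.reduceModIdeal_apply,
    AdicCompletion.val_zero_apply, Submodule.Quotient.mk_eq_zero, Algebra.linearMap_apply] at h
  rw [AdicCompletion.smul_eval, ← hr, ← hz, AdicCompletion.val_zero_apply]
  change Submodule.Quotient.mk (r • z) = _
  rw [Submodule.Quotient.mk_eq_zero]
  rw [Ideal.smul_top_eq_map, Submodule.restrictScalars_mem] at h ⊢
  rw [Algebra.smul_def]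
  exact Ideal.mul_mem_right _ _ h

theorem AdicCompletion.map_smul_apply {R : Type*} [CommRing R] (I : Ideal R) {M N : Type*}
    [AddCommGroup M] [Module R M] [AddCommGroup N] [Module R N] (g : R) (f : M →ₗ[R] N)
    (x : AdicCompletion I M) :
    AdicCompletion.map I (g • f) x = g • AdicCompletion.map I f x := by
  refine AdicCompletion.ext fun k => ?_
  obtain ⟨z, hz⟩ := Submodule.Quotient.mk_surjective _ (x.val k)
  rw [AdicCompletion.val_smul_apply, AdicCompletion.map_val_apply, AdicCompletion.map_val_apply,
    ← hz]
  rfl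

/-- A finitely generated module over a domain whose completion is killed by a nonzero element of
the completed ring is a torsion module. -/
theorem exists_smul_eq_zero_of_completion_smul_eq_zero {R : Type u} [CommRing R] [IsDomain R]
    [IsNoetherianRing R] (I : Ideal R) {M : Type u} [AddCommGroup M] [Module R M]
    [Module.Finite R M] {a : AdicCompletion I R} (ha : a ≠ 0)
    (haM : ∀ y : AdicCompletion I M, a • y = 0) :
    ∃ g : R, g ≠ 0 ∧ ∀ m : M, g • m = 0 := by
  have htors : Module.IsTorsion R M := by
    intro m
    by_contra hm
    have hinj : Function.Injective (LinearMap.toSpanSingleton R M m) := by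
      rw [injective_iff_map_eq_zero]
      intro r hr
      by_contra hr0
      exact hm ⟨⟨r, mem_nonZeroDivisors_of_ne_zero hr0⟩, by simpa using hr⟩
    refine ha (AdicCompletion.map_injective I hinj ?_)
    rw [map_zero, ← mul_one a, ← smul_eq_mul, map_smul, haM]
  obtain ⟨g, hg, hg0⟩ := Submodule.annihilator_top_inter_nonZeroDivisors htors
  refine ⟨g, nonZeroDivisors.ne_zero hg0, fun m => ?_⟩
  exact Submodule.mem_annihilator.1 hg m trivial

variable {R : Type u} [CommRing R] [IsLocalRing R] {S : Type v} [CommRing S] [Algebra R S]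

/-- Already modulo `𝔪 S_P`, a proper ideal, `1` survives. -/
theorem of_one_localization_ne_zero (P : (maximalIdeal R).primesOver S) :
    AdicCompletion.of (maximalIdeal R) (Localization.AtPrime P.1) 1 ≠ 0 := by
  intro h
  have h1 := congrArg (fun t => t.val 1) h
  simp only [AdicCompletion.of_apply, AdicCompletion.val_zero_apply, Submodule.mkQ_apply,
    Submodule.Quotient.mk_eq_zero, pow_one] at h1
  rw [mem_smul_top_localization_iff] at h1
  have hle : ((maximalIdeal R).map (algebraMap R S)).map
      (algebraMap S (Localization.AtPrime P.1)) ≤ maximalIdeal (Localization.AtPrime P.1) := by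
    rw [Ideal.map_le_iff_le_comap, ← Ideal.under_def, Localization.AtPrime.under_maximalIdeal,
      Ideal.map_le_iff_le_comap, ← Ideal.under_def, ← P.2.2.over]
  exact (Ideal.ne_top_iff_one _).1 (maximalIdeal.isMaximal _).ne_top (hle h1)

theorem not_isAlgebraicModule_localCompletion [IsDomain R] [IsNoetherianRing R]
    [Module.Finite R S] [Finite ((maximalIdeal R).primesOver S)] {F : S →ₗ[R] R}
    (hF : Function.Injective F) {f : R} (hFf : ∀ x, algebraMap R S (F x) = f • x)
    {P Q : (maximalIdeal R).primesOver S} (hPQ : P ≠ Q) :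
    ¬ IsAlgebraicModule R (MaxCompletion R (Localization.AtPrime P.1)) := by
  classical
  rintro ⟨M, _, _, hM, ⟨φ⟩⟩
  have : IsNoetherianRing S := IsNoetherianRing.of_finite R S
  have hsurj := (bijective_completionToLocalCompletions (R := R) (S := S)).2
  have hFinj := AdicCompletion.map_injective_of_finite (maximalIdeal R) hF
  -- `e` and `e'` correspond to the unit vectors at `Q` and `P`.
  obtain ⟨e, he⟩ := hsurj (Pi.single Q (AdicCompletion.of _ _ 1))
  obtain ⟨e', he'⟩ := hsurj (Pi.single P (AdicCompletion.of _ _ 1))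
  have he0 : e ≠ 0 := by
    rintro rfl
    apply of_one_localization_ne_zero Q
    simpa using (congrFun he Q).symm
  have he'0 : e' ≠ 0 := by
    rintro rfl
    apply of_one_localization_ne_zero P
    simpa using (congrFun he' P).symm
  have ha0 : AdicCompletion.map (maximalIdeal R) F e ≠ 0 := fun h =>
    he0 (hFinj (h.trans (map_zero _).symm))
  -- As `F` is multiplication by `f`, the image of `F̂(e)` in `Ŝ_P` is `f` times the `P` component
  -- of `e`, which is zero.
  have hcomp : Algebra.linearMap R (Localization.AtPrime P.1) ∘ₗ F =
      f • (IsScalarTower.toAlgHom R S (Localization.AtPrime P.1)).toLinearMap := by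
    ext x
    simp only [LinearMap.comp_apply, Algebra.linearMap_apply, LinearMap.smul_apply,
      AlgHom.toLinearMap_apply, IsScalarTower.coe_toAlgHom']
    rw [IsScalarTower.algebraMap_apply R S, hFf, Algebra.smul_def, Algebra.smul_def, map_mul,
      ← IsScalarTower.algebraMap_apply]
  have hkill : ∀ y : MaxCompletion R (Localization.AtPrime P.1),
      AdicCompletion.map (maximalIdeal R) F e • y = 0 := by
    refine AdicCompletion.smul_eq_zero_of_map_linearMap_eq_zero _ ?_
    rw [AdicCompletion.map_comp_apply, hcomp, AdicCompletion.map_smul_apply]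
    have h : AdicCompletion.map (maximalIdeal R)
      (IsScalarTower.toAlgHom R S (Localization.AtPrime P.1)).toLinearMap e = 0 := by
      have := congrFun he P
      rwa [Pi.single_eq_of_ne hPQ] at this
    rw [h, smul_zero]
  obtain ⟨g, hg0, hg⟩ := exists_smul_eq_zero_of_completion_smul_eq_zero (M := M) (maximalIdeal R)
    ha0 (fun y => φ.injective (by rw [map_smul, hkill, map_zero]))
  have hgM : ∀ y : MaxCompletion R M, g • y = 0 := fun y => by
    have h0 : g • (LinearMap.id : M →ₗ[R] M) = 0 := by ext m; exact hg m
    have h1 := AdicCompletion.map_smul_apply (maximalIdeal R) g (LinearMap.id : M →ₗ[R] M) y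
    rw [h0, AdicCompletion.map_zero, AdicCompletion.map_id] at h1
    exact h1.symm
  have hgP : ∀ y : MaxCompletion R (Localization.AtPrime P.1), g • y = 0 := fun y => by
    obtain ⟨x, rfl⟩ := φ.surjective y
    rw [← algebraMap_smul (MaxCompletion R R) g, ← map_smul, algebraMap_smul, hgM, map_zero]
  have hge' : g • e' = 0 := by
    apply (bijective_completionToLocalCompletions (R := R) (S := S)).1
    rw [← algebraMap_smul (MaxCompletion R R) g, map_smul, he', map_zero, ← Pi.single_smul,
      algebraMap_smul, hgP, Pi.single_zero]
  -- Multiplication by `g` is injective on the domain `R`, hence on its completion.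
  have hginj : Function.Injective
      (AdicCompletion.map (maximalIdeal R) (g • (LinearMap.id : R →ₗ[R] R))) :=
    AdicCompletion.map_injective _ (fun x y h => mul_left_cancel₀ hg0 h)
  refine he'0 (hFinj (hginj ?_))
  rw [AdicCompletion.map_smul_apply, AdicCompletion.map_id, LinearMap.id_apply, map_zero, map_zero,
    ← algebraMap_smul (MaxCompletion R R) g, ← map_smul, algebraMap_smul, hge', map_zero]

theorem IsAlgebraicModule.of_linearEquiv {N : Type*} {N' : Type*} [AddCommGroup N]
    [Module (MaxCompletion R R) N] [AddCommGroup N'] [Module (MaxCompletion R R) N']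
    (h : IsAlgebraicModule R N) (e : N ≃ₗ[MaxCompletion R R] N') : IsAlgebraicModule R N' := by
  obtain ⟨M, i, j, hM, ⟨φ⟩⟩ := h
  exact ⟨M, i, j, hM, ⟨φ.trans e⟩⟩

theorem isAlgebraicModule_maxCompletion (N : Type v) [AddCommGroup N] [Module R N]
    [Module.Finite R N] : IsAlgebraicModule R (MaxCompletion R N) := by
  obtain ⟨n, L, ⟨e⟩⟩ := Module.Finite.exists_fin_quot_equiv R N
  exact ⟨_, inferInstance, inferInstance, inferInstance, ⟨AdicCompletion.congr _ e⟩⟩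

theorem AdicCompletion.finite_of_finite {R : Type*} [CommRing R] (I : Ideal R) (N : Type*)
    [AddCommGroup N] [Module R N] [Module.Finite R N] :
    Module.Finite (AdicCompletion I R) (AdicCompletion I N) :=
  Module.Finite.of_surjective _ (AdicCompletion.ofTensorProduct_surjective_of_finite I N)

/-- If a module decomposes as a product, strong algebraicity passes to each factor. -/
theorem IsStronglyAlgebraicModule.factor {ι : Type*} {N : Type*} [AddCommGroup N]
    [Module (MaxCompletion R R) N] {A : ι → Type*} [∀ i, AddCommGroup (A i)]
    [∀ i, Module (MaxCompletion R R) (A i)] (h : IsStronglyAlgebraicModule R N)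
    (e : N ≃ₗ[MaxCompletion R R] (∀ i, A i)) (i : ι) : IsAlgebraicModule R (A i) := by
  classical
  let s : A i →ₗ[MaxCompletion R R] N := e.symm.toLinearMap ∘ₗ LinearMap.single _ A i
  let p : N →ₗ[MaxCompletion R R] A i := LinearMap.proj i ∘ₗ e.toLinearMap
  have hps : ∀ x, p (s x) = x := fun x => by simp [p, s]
  have hs : Function.Injective s := Function.LeftInverse.injective hps
  -- `s` is a section of `p`, so `N` is the image of `s` plus the kernel of `p`.
  have hcompl : IsCompl (LinearMap.range s) (LinearMap.ker p) := by
    have := LinearMap.isCompl_of_proj (p := LinearMap.range s) (f := s.rangeRestrict ∘ₗ p) (by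
      rintro ⟨_, x, rfl⟩
      ext
      simp [hps])
    rwa [LinearMap.ker_comp_of_ker_eq_bot] at this
    rw [LinearMap.ker_rangeRestrict, LinearMap.ker_eq_bot]
    exact hs
  exact (h _ _ hcompl).of_linearEquiv (LinearEquiv.ofInjective s hs).symm

end AlgebraicModules

theorem exists_injective_linearMap_integralClosure (R : Type u) [CommRing R] [IsDomain R]
    (K : Type v) [Field K] [Algebra R K] [IsFractionRing R K]
    [Module.Finite R (integralClosure R K)] :
    ∃ (f : R) (F : integralClosure R K →ₗ[R] R), Function.Injective F ∧
      ∀ x, algebraMap R (integralClosure R K) (F x) = f • x := by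
  have hinj : Function.Injective (Algebra.linearMap R K) := IsFractionRing.injective R K
  have hfg : (Subalgebra.toSubmodule (integralClosure R K)).FG :=
    Module.Finite.iff_fg.1 ‹Module.Finite R (integralClosure R K)›
  -- `f` is a common denominator of finitely many generators.
  obtain ⟨f, hf0, hf⟩ := FractionalIdeal.isFractional_of_fg (S := nonZeroDivisors R) hfg
  let G : integralClosure R K →ₗ[R] LinearMap.range (Algebra.linearMap R K) :=
    (f • (integralClosure R K).val.toLinearMap).codRestrict _ fun x => hf x x.2
  have hG : ∀ x, ((G x : LinearMap.range (Algebra.linearMap R K)) : K) = f • (x : K) :=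
    fun _ => rfl
  let E := LinearEquiv.ofInjective (Algebra.linearMap R K) hinj
  have hE : ∀ x, algebraMap R K (E.symm (G x)) = f • (x : K) := fun x =>
    (congrArg Subtype.val (E.apply_symm_apply (G x))).trans (hG x)
  refine ⟨f, E.symm.toLinearMap ∘ₗ G, E.symm.injective.comp fun x y hxy => ?_, fun x =>
    Subtype.ext (hE x)⟩
  have h : f • (x : K) = f • (y : K) := congrArg Subtype.val hxy
  rw [Algebra.smul_def, Algebra.smul_def] at h
  exact Subtype.ext (mul_left_cancel₀ ((map_ne_zero_iff _ hinj).2 (nonZeroDivisors.ne_zero hf0)) h)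

theorem proposition2p5 (R : Type u) [CommRing R] [IsDomain R] [IsLocalRing R] [IsNoetherianRing R]
    (K : Type v) [Field K] [Algebra R K] [IsFractionRing R K]
    (hfin : Module.Finite R (integralClosure R K))
    (hnonlocal : ¬ IsLocalRing (integralClosure R K))
    (hsing : HasIsolatedSingularity R) :
    Module.Finite (MaxCompletion R R) (MaxCompletion R (integralClosure R K)) ∧
    IsAlgebraicModule R (MaxCompletion R (integralClosure R K)) ∧
    ¬ IsStronglyAlgebraicModule R (MaxCompletion R (integralClosure R K)) ∧
    ((IsLocalRing.maximalIdeal R).primesOver (integralClosure R K)).Finite ∧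
    Function.Bijective (completionToLocalCompletions R (integralClosure R K)) ∧
    ∀ P : (IsLocalRing.maximalIdeal R).primesOver (integralClosure R K),
      ¬ IsAlgebraicModule R (MaxCompletion R (Localization.AtPrime P.1)) := by
  have hprimes : ((maximalIdeal R).primesOver (integralClosure R K)).Finite :=
    Algebra.QuasiFinite.finite_primesOver _
  have := hprimes.to_subtype
  have : IsNoetherianRing (integralClosure R K) := IsNoetherianRing.of_finite R _
  have hbij := bijective_completionToLocalCompletions (R := R) (S := integralClosure R K)
  obtain ⟨f, F, hF, hFf⟩ := exists_injective_linearMap_integralClosure R K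
  have hnot : ∀ P : (maximalIdeal R).primesOver (integralClosure R K),
      ¬ IsAlgebraicModule R (MaxCompletion R (Localization.AtPrime P.1)) := by
    intro P
    -- Were `P` the only prime over `𝔪`, it would be the only maximal ideal.
    obtain ⟨Q, hQ⟩ : ∃ Q, P ≠ Q := by
      by_contra! hall
      refine hnonlocal (IsLocalRing.of_unique_max_ideal ⟨P.1, inferInstance, fun Q hQ => ?_⟩)
      exact (congrArg Subtype.val (hall ⟨Q, mem_primesOver_maximalIdeal_of_isMaximal Q⟩)).symm
    exact not_isAlgebraicModule_localCompletion hF hFf hQ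
  obtain ⟨P⟩ : Nonempty ((maximalIdeal R).primesOver (integralClosure R K)) := by
    obtain ⟨P, hP⟩ := Ideal.exists_maximal (integralClosure R K)
    exact ⟨⟨P, mem_primesOver_maximalIdeal_of_isMaximal P⟩⟩
  exact ⟨AdicCompletion.finite_of_finite _ _, isAlgebraicModule_maxCompletion _,
    fun h => hnot P (h.factor (LinearEquiv.ofBijective _ hbij) P), hprimes, hbij, hnot⟩
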